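/- For a cone $C$ in a normed space and a bounded positively homogeneous map $A:C\to C$ put $\|A\|=\sup\{\|Ax\|/\|x\|: x\in C,\ x\ne 0\}$ and let $r(A)=\lim_{n\to\infty}\|A^n\|^{1/n}$ be the Bonsall cone spectral radius. Consider the following two classes of maps. (I) $M$ is a nonempty set, $C$ is the cone of nonnegative functions in the space of bounded real functions on $M$ with the supremum norm, and the maps are $A:C\to C$, $(Af)(s)=\sup_{t\in M}k(s,t)f(t)$, with a bounded kernel $k:M\times M\to[0,\infty)$. (II) $a>0$, $\alpha\le\beta$ are fixed continuous functions $[0,a]\to[0,a]$, $S=\{(s,t)\in[0,a]^2:\alpha(s)\le t\le\beta(s)\}$, $C$ is the cone of nonnegative functions in $C[0,a]$ with the supremum norm, and the maps are $A:C\to C$, $(Ax)(s)=\max_{\alpha(s)\le t\le\beta(s)}k(s,t)x(t)$, with a continuous kernel $k:S\to[0,\infty)$. Products of maps are compositions. The product $AB$ of maps with kernels $k,h$ has the kernel $(s,u)\mapsto\sup_t k(s,t)h(t,u)$, where in (II) kernels are extended by $0$ outside $S$. The Hadamard product $A\circ B$ is the operator whose kernel is the pointwise product of the kernels of $A$ and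 $B$, and similarly for several factors. In (II) the kernel of a Hadamard product of products of maps (such as $AB\circ BA$) need not be continuous. Such a Hadamard product is the operator $f\mapsto\sup_{t\in[0,a]}K(\cdot,t)f(t)$, with $K$ its kernel, on the nonnegative bounded functions on $[0,a]$. If this operator maps nonnegative continuous functions to continuous functions, it may instead be taken as a map on the cone $C$ of (II); the assertions below hold in both readings. For a polynomial $q(z)=\sum_{j=0}^n\alpha_jz^j$ with all $\alpha_j\ge0$ and $m\in\{1,2,\dots\}$ put $$q_\vee(A)x=\bigvee_{j=0}^n\alpha_jA^jx,\qquad q^{[m]}(z)=\sum_{j=0}^n\alpha_j^mz^j .$$ **Theorem.** Let $q$ be such a polynomial, $m\ge1$, let $A_1,\dots,A_m,A,B$ be maps all of class (I) for the same $M$, or all of class (II) for the same $a,\alpha,\beta$, and let $P_i=A_iA_{i+1}\cdots A_mA_1\cdots A_{i-1}$ for $i=1,\dots,m$. Then $$r\big(q_\vee(A_1\circ\cdots\circ A_m)\big)\le r\big(q_\vee^{[m]}(P_1\circ\cdots\circ P_m)\big)^{1/m}\le r\big(q_\vee(A_1\cdots A_m)\big),$$ $$r\big(q_\vee(A\circ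 B)\big)\le r\big(q_\vee^{[2]}(AB\circ BA)\big)^{1/2}\le r\big(q_\vee(AB)\big),$$ $$r\big(q_\vee(AB\circ BA)\big)\le r\big(q_\vee(A^2B^2)\big).$$ -/

import Mathlib

open Filter Topology
open scoped NNReal ENNReal

noncomputable section

/-! ### The Bonsall cone spectral radius -/

section Radius

variable {X : Type*} [NormedAddCommGroup X] {C : Set X}

/-- `‖A‖ = sup {‖A x‖ / ‖x‖ : x ∈ C, x ≠ 0}`, with values in `[0, ∞]`. In the monoid
`Function.End C` the product `A * B` is the composition and `A ^ n` the iterate. -/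
def coneNorm (A : Function.End C) : ℝ≥0∞ :=
  ⨆ (x : C) (_ : (x : X) ≠ 0), ‖(A x : X)‖ₑ / ‖(x : X)‖ₑ

/-- The Bonsall cone spectral radius `lim ‖A ^ n‖ ^ (1 / n)`. It is written as an upper limit so
that it makes sense for all maps; see `tendsto_bonsallRadius` for the limit. -/
def bonsallRadius (A : Function.End C) : ℝ≥0∞ :=
  limsup (fun n : ℕ => coneNorm (A ^ n) ^ (1 / (n : ℝ))) atTop

theorem enorm_le_coneNorm_mul {A : Function.End C} (h0 : ∀ x : C, (x : X) = 0 → (A x : X) = 0)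
    (x : C) : ‖(A x : X)‖ₑ ≤ coneNorm A * ‖(x : X)‖ₑ := by
  by_cases hx : (x : X) = 0
  · simp [h0 x hx]
  · have h : ‖(A x : X)‖ₑ / ‖(x : X)‖ₑ ≤ coneNorm A :=
      le_iSup₂ (f := fun (x : C) (_ : (x : X) ≠ 0) => ‖(A x : X)‖ₑ / ‖(x : X)‖ₑ) x hx
    rwa [ENNReal.div_le_iff (by simpa using hx) (by simp)] at h

theorem coneNorm_mul_le {A B : Function.End C} (hA : ∀ x : C, (x : X) = 0 → (A x : X) = 0)
    (hB : ∀ x : C, (x : X) = 0 → (B x : X) = 0) :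
    coneNorm (A * B) ≤ coneNorm A * coneNorm B := by
  refine iSup₂_le fun x hx => ?_
  rw [ENNReal.div_le_iff (by simpa using hx) (by simp)]
  calc ‖((A * B) x : X)‖ₑ ≤ coneNorm A * ‖(B x : X)‖ₑ := enorm_le_coneNorm_mul hA (B x)
    _ ≤ coneNorm A * (coneNorm B * ‖(x : X)‖ₑ) := by
        gcongr
        exact enorm_le_coneNorm_mul hB x
    _ = _ := (mul_assoc _ _ _).symm

theorem exists_tendsto_rpow_of_submul {u : ℕ → ℝ≥0∞} (hu : ∀ m n, u (m + n) ≤ u m * u n)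
    (hfin : ∀ n, u n ≠ ∞) :
    Tendsto (fun n : ℕ => u n ^ (1 / (n : ℝ))) atTop
      (𝓝 (⨅ (n : ℕ) (_ : n ≠ 0), u n ^ (1 / (n : ℝ)))) := by
  refine tendsto_order.2 ⟨fun l hl => ?_, fun L hL => ?_⟩
  · filter_upwards [eventually_ne_atTop 0] with n hn
    exact hl.trans_le (iInf₂_le n hn)
  · by_cases hz : ∃ n, u n = 0
    · obtain ⟨n, hn⟩ := hz
      filter_upwards [eventually_ge_atTop n, eventually_ne_atTop 0] with p hp hp0
      have h0 : u p = 0 := by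
        have := hu n (p - n)
        rw [Nat.add_sub_cancel' hp, hn, zero_mul] at this
        exact le_antisymm this zero_le
      have hp' : (0 : ℝ) < 1 / (p : ℝ) := by positivity
      rw [h0, ENNReal.zero_rpow_of_pos hp']
      exact lt_of_le_of_lt zero_le hL
    · have hz' : ∀ n, u n ≠ 0 := fun n h => hz ⟨n, h⟩
      have hpos : ∀ n, 0 < (u n).toReal := fun n => ENNReal.toReal_pos (hz' n) (hfin n)
      have key : ∀ (n : ℕ) (R : ℝ≥0∞), R ≠ 0 → R ≠ ∞ →
          ((u n ^ (1 / (n : ℝ))) < R ↔ Real.log (u n).toReal / n < Real.log R.toReal) := by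
        intro n R hR0 hR
        have hR' : 0 < R.toReal := ENNReal.toReal_pos hR0 hR
        have hne : u n ^ (1 / (n : ℝ)) ≠ ∞ :=
          ENNReal.rpow_ne_top_of_nonneg (by positivity) (hfin n)
        rw [← ENNReal.toReal_lt_toReal hne hR, ← ENNReal.toReal_rpow,
          ← Real.log_lt_log_iff (Real.rpow_pos_of_pos (hpos n) _) hR', Real.log_rpow (hpos n)]
        rw [one_div, inv_mul_eq_div]
      have hsub : Subadditive fun n => Real.log (u n).toReal := by
        intro m n
        rw [← Real.log_mul (hpos m).ne' (hpos n).ne', ← ENNReal.toReal_mul]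
        refine Real.log_le_log (hpos _) ?_
        exact ENNReal.toReal_mono (ENNReal.mul_ne_top (hfin m) (hfin n)) (hu m n)
      obtain ⟨n, hn, hnL⟩ : ∃ n : ℕ, n ≠ 0 ∧ u n ^ (1 / (n : ℝ)) < L := by
        simpa [iInf_lt_iff] using hL
      obtain ⟨R, hR1, hR2⟩ := exists_between hnL
      have hR0 : R ≠ 0 := (lt_of_le_of_lt zero_le hR1).ne'
      have hR : R ≠ ∞ := hR2.ne_top
      filter_upwards [hsub.eventually_div_lt_of_div_lt hn ((key n R hR0 hR).1 hR1)] with p hp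
      exact ((key p R hR0 hR).2 hp).trans hR2

/-- For bounded maps that fix the vertex (for instance positively homogeneous ones), the limit
defining the spectral radius exists and is the infimum of `‖A ^ n‖ ^ (1 / n)` over `n ≥ 1`. -/
theorem tendsto_bonsallRadius {A : Function.End C}
    (h0 : ∀ x : C, (x : X) = 0 → (A x : X) = 0) (hA : coneNorm A ≠ ∞) :
    Tendsto (fun n : ℕ => coneNorm (A ^ n) ^ (1 / (n : ℝ))) atTop (𝓝 (bonsallRadius A)) ∧
      bonsallRadius A = ⨅ (n : ℕ) (_ : n ≠ 0), coneNorm (A ^ n) ^ (1 / (n : ℝ)) := by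
  have h0n : ∀ (n : ℕ) (x : C), (x : X) = 0 → ((A ^ n) x : X) = 0 := by
    intro n
    induction n with
    | zero => intro x hx; exact hx
    | succ k ih =>
      intro x hx
      rw [pow_succ]
      exact ih (A x) (h0 x hx)
  have hone : coneNorm (1 : Function.End C) ≤ 1 :=
    iSup₂_le fun x _ => ENNReal.div_self_le_one
  have hfin : ∀ n : ℕ, coneNorm (A ^ n) ≠ ∞ := by
    intro n
    induction n with
    | zero => rw [pow_zero]; exact ne_top_of_le_ne_top ENNReal.one_ne_top hone
    | succ k ih =>
      rw [pow_succ]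
      exact ne_top_of_le_ne_top (ENNReal.mul_ne_top ih hA) (coneNorm_mul_le (h0n k) h0)
  have ht := exists_tendsto_rpow_of_submul (u := fun n => coneNorm (A ^ n))
    (fun m n => by rw [pow_add]; exact coneNorm_mul_le (h0n m) (h0n n)) hfin
  have he : bonsallRadius A = ⨅ (n : ℕ) (_ : n ≠ 0), coneNorm (A ^ n) ^ (1 / (n : ℝ)) :=
    ht.limsup_eq
  exact ⟨he ▸ ht, he⟩

end Radius

/-! ### Maxpolynomials of a map of the positive cone -/

section MaxPoly

/-- The positive cone `X₊` of an ordered vector space. -/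
abbrev PosCone (X : Type*) [Zero X] [Preorder X] : Set X := Set.Ici (0 : X)

variable {X : Type*} [AddCommGroup X] [Lattice X] [Module ℝ X] [PosSMulMono ℝ X]

/-- `q_∨(A) x = ⋁_{j = 0}^n α_j A ^ j x` for `q = ∑_{j = 0}^n α_j z ^ j` with `α_j ≥ 0`
(the supremum is taken in the positive cone). -/
def maxPoly (q : Polynomial ℝ≥0) (A : Function.End (PosCone X)) : Function.End (PosCone X) :=
  fun x => (Finset.range (q.natDegree + 1)).sup fun j =>
    ⟨(q.coeff j : ℝ) • ((A ^ j) x : X), smul_nonneg (q.coeff j).2 ((A ^ j) x).2⟩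

/-- `q^{[m]} = ∑ α_j ^ m z ^ j` for `q = ∑ α_j z ^ j`. -/
def coeffPow (m : ℕ) (q : Polynomial ℝ≥0) : Polynomial ℝ≥0 :=
  ∑ j ∈ Finset.range (q.natDegree + 1), Polynomial.monomial j (q.coeff j ^ m)

end MaxPoly

/-! ### Sup-kernel operators on bounded functions -/

section Bounded

/-- The normed vector lattice of all bounded real functions on `M` with the supremum norm
(realised as bounded continuous functions for the discrete topology on `M`). -/
abbrev BddFun (M : Type*) := @BoundedContinuousFunction M ℝ ⊥ _

variable {M : Type*}

instance : PosSMulMono ℝ (BddFun M) where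
  smul_le_smul_of_nonneg_left _ ha _ _ hfg := fun t =>
    mul_le_mul_of_nonneg_left (hfg t) ha

theorem BddFun.apply_le_norm (f : BddFun M) (t : M) : f t ≤ ‖f‖ :=
  (le_abs_self _).trans
    (@BoundedContinuousFunction.norm_coe_le_norm M ℝ ⊥ _ f t)

variable (M) in
/-- The bounded nonnegative kernels on `M × M`. The product `k * h` of two kernels (and `∏ i, k i`)
is the pointwise one: it is the kernel of the Hadamard product of the operators. -/
def BddKernel : Submonoid (M → M → ℝ≥0) where
  carrier := {k | ∃ b : ℝ≥0, ∀ s t, k s t ≤ b}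
  one_mem' := ⟨1, fun _ _ => le_rfl⟩
  mul_mem' := by
    rintro k h ⟨b, hb⟩ ⟨c, hc⟩
    exact ⟨b * c, fun s t => mul_le_mul' (hb s t) (hc s t)⟩

theorem BddKernel.exists_bound (k : BddKernel M) (f : PosCone (BddFun M)) :
    ∃ b : ℝ, 0 ≤ b ∧ ∀ s t, (k.1 s t : ℝ) * f.1 t ≤ b := by
  obtain ⟨b, hb⟩ := k.2
  refine ⟨b * ‖f.1‖, by positivity, fun s t => ?_⟩
  exact mul_le_mul (by exact_mod_cast hb s t) (f.1.apply_le_norm t) (f.2 t) b.2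

theorem BddKernel.bddAbove (k : BddKernel M) (f : PosCone (BddFun M)) (s : M) :
    BddAbove (Set.range fun t => (k.1 s t : ℝ) * f.1 t) := by
  obtain ⟨b, -, hb⟩ := BddKernel.exists_bound k f
  exact ⟨b, by rintro _ ⟨t, rfl⟩; exact hb s t⟩

theorem BddKernel.iSup_nonneg (k : BddKernel M) (f : PosCone (BddFun M)) (s : M) :
    0 ≤ ⨆ t, (k.1 s t : ℝ) * f.1 t :=
  Real.iSup_nonneg fun t => mul_nonneg (k.1 s t).2 (f.2 t)

/-- The operator `(A f)(s) = sup {k(s, t) f(t) : t ∈ M}` on the nonnegative bounded functions. -/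
def supOp (k : BddKernel M) : Function.End (PosCone (BddFun M)) := fun f =>
  ⟨@BoundedContinuousFunction.ofNormedAddCommGroup M ℝ ⊥ _
      (fun s => ⨆ t, (k.1 s t : ℝ) * f.1 t) continuous_bot (BddKernel.exists_bound k f).choose (fun s => by
        rw [Real.norm_of_nonneg (BddKernel.iSup_nonneg k f s)]
        exact Real.iSup_le ((BddKernel.exists_bound k f).choose_spec.2 s)
          (BddKernel.exists_bound k f).choose_spec.1),
    fun s => BddKernel.iSup_nonneg k f s⟩

theorem supOp_apply (k : BddKernel M) (f : PosCone (BddFun M)) (s : M) :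
    (supOp k f).1 s = ⨆ t, (k.1 s t : ℝ) * f.1 t := rfl

/-- The kernel `sup {k(s, t) h(t, u) : t ∈ M}` of the product of the operators with kernels
`k` and `h`. -/
def kernelComp (k h : BddKernel M) : BddKernel M :=
  ⟨fun s u => ⨆ t, k.1 s t * h.1 t u, by
    obtain ⟨b, hb⟩ := k.2
    obtain ⟨c, hc⟩ := h.2
    exact ⟨b * c, fun s u => ciSup_le' fun t => mul_le_mul' (hb s t) (hc t u)⟩⟩

open scoped Classical in
/-- The kernel of the identity map. -/
def kernelId : BddKernel M :=
  ⟨fun s t => if s = t then 1 else 0, 1, fun s t => by dsimp only; split_ifs <;> simp⟩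

/-- The kernel of the product `A₁ ⋯ A_n` of the operators with the listed kernels. -/
def kernelProd (l : List (BddKernel M)) : BddKernel M := l.foldr kernelComp kernelId

/-- An operator has only one kernel. -/
theorem supOp_injective : Function.Injective (supOp (M := M)) := by
  classical
  intro k h hkh
  ext s t
  let e : PosCone (BddFun M) :=
    ⟨@BoundedContinuousFunction.ofNormedAddCommGroup M ℝ ⊥ _ (fun u => if u = t then 1 else 0)
      continuous_bot 1 (fun u => by split_ifs <;> simp), fun u => by
        change (0 : ℝ) ≤ if u = t then 1 else 0
        split_ifs <;> simp⟩
  have he : ∀ k : BddKernel M, (supOp k e).1 s = k.1 s t := by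
    intro k
    have he' : ∀ u, e.1 u = if u = t then 1 else 0 := fun _ => rfl
    rw [supOp_apply]
    apply le_antisymm
    · have : Nonempty M := ⟨t⟩
      refine ciSup_le fun u => ?_
      rw [he']
      split_ifs with hu
      · simp [hu]
      · simp
    · refine le_ciSup_of_le (BddKernel.bddAbove k e s) t ?_
      simp [he']
  rw [← he k, ← he h, hkh]

theorem supOp_kernelComp (k h : BddKernel M) : supOp (kernelComp k h) = supOp k * supOp h := by
  funext f
  apply Subtype.ext
  apply @BoundedContinuousFunction.ext M ℝ ⊥ _
  intro s
  change (⨆ u, ((⨆ t, k.1 s t * h.1 t u : ℝ≥0) : ℝ) * f.1 u) =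
    ⨆ t, (k.1 s t : ℝ) * ⨆ u, (h.1 t u : ℝ) * f.1 u
  have h1 : ∀ u, ((⨆ t, k.1 s t * h.1 t u : ℝ≥0) : ℝ) * f.1 u =
      ⨆ t, (k.1 s t : ℝ) * ((h.1 t u : ℝ) * f.1 u) := by
    intro u
    rw [NNReal.coe_iSup, Real.iSup_mul_of_nonneg (show (0 : ℝ) ≤ f.1 u from f.2 u)]
    simp only [NNReal.coe_mul, mul_assoc]
  have h2 : ∀ t, (k.1 s t : ℝ) * (⨆ u, (h.1 t u : ℝ) * f.1 u) =
      ⨆ u, (k.1 s t : ℝ) * ((h.1 t u : ℝ) * f.1 u) := fun t =>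
    Real.mul_iSup_of_nonneg (NNReal.coe_nonneg _) _
  rw [iSup_congr h1, iSup_congr h2]
  have : Nonempty M := ⟨s⟩
  obtain ⟨b, hb⟩ := k.2
  obtain ⟨c, hc0, hc⟩ := BddKernel.exists_bound h f
  have hbd : ∀ t u, (k.1 s t : ℝ) * ((h.1 t u : ℝ) * f.1 u) ≤ b * c := fun t u =>
    mul_le_mul (by exact_mod_cast hb s t) (hc t u) (mul_nonneg (h.1 t u).2 (f.2 u)) b.2
  apply le_antisymm
  · refine ciSup_le fun u => ciSup_le fun t => ?_
    refine le_ciSup_of_le ⟨b * c, ?_⟩ t (le_ciSup_of_le ⟨b * c, ?_⟩ u le_rfl)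
    · rintro _ ⟨t, rfl⟩; exact ciSup_le (hbd t)
    · rintro _ ⟨u, rfl⟩; exact hbd t u
  · refine ciSup_le fun t => ciSup_le fun u => ?_
    refine le_ciSup_of_le ⟨b * c, ?_⟩ u (le_ciSup_of_le ⟨b * c, ?_⟩ t le_rfl)
    · rintro _ ⟨u, rfl⟩; exact ciSup_le fun t => hbd t u
    · rintro _ ⟨t, rfl⟩; exact hbd t u

theorem supOp_kernelId : supOp (kernelId : BddKernel M) = 1 := by
  classical
  funext f
  apply Subtype.ext
  apply @BoundedContinuousFunction.ext M ℝ ⊥ _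
  intro s
  change (supOp kernelId f).1 s = f.1 s
  rw [supOp_apply]
  have : Nonempty M := ⟨s⟩
  apply le_antisymm
  · refine ciSup_le fun t => ?_
    by_cases hst : s = t
    · simp [kernelId, hst]
    · simpa [kernelId, hst] using f.2 s
  · exact le_ciSup_of_le (BddKernel.bddAbove kernelId f s) s (by simp [kernelId])

/-- `kernelProd` gives the kernel of a product of operators. -/
theorem supOp_kernelProd (l : List (BddKernel M)) :
    supOp (kernelProd l) = (l.map supOp).prod := by
  induction l with
  | nil => exact supOp_kernelId
  | cons k l ih =>
    rw [List.map_cons, List.prod_cons, ← ih]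
    exact supOp_kernelComp k (kernelProd l)

end Bounded

/-! ### Max-type kernel operators on `C[0, a]` -/

section Continuous

/-- A pair of continuous functions `α ≤ β` from `[0, a]` to `[0, a]`. -/
structure Band (a : ℝ) where
  lower : C(Set.Icc (0 : ℝ) a, Set.Icc (0 : ℝ) a)
  upper : C(Set.Icc (0 : ℝ) a, Set.Icc (0 : ℝ) a)
  lower_le_upper : ∀ s, lower s ≤ upper s

variable {a : ℝ}

/-- `S = {(s, t) : α(s) ≤ t ≤ β(s)}`. -/
def Band.region (D : Band a) : Set (Set.Icc (0 : ℝ) a × Set.Icc (0 : ℝ) a) :=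
  {p | D.lower p.1 ≤ p.2 ∧ p.2 ≤ D.upper p.1}

/-- The continuous kernels `k : S → [0, ∞)`. The product `k * h` of two kernels (and `∏ i, k i`)
is the pointwise one: it is the kernel of the Hadamard product of the operators. -/
abbrev Band.Kernel (D : Band a) := C(D.region, ℝ≥0)

variable {D : Band a}

theorem Band.isClosed_region (D : Band a) : IsClosed D.region :=
  IsClosed.inter (isClosed_le (by fun_prop) (by fun_prop))
    (isClosed_le (by fun_prop) (by fun_prop))

instance : CompactSpace D.region := isCompact_iff_compactSpace.1 D.isClosed_region.isCompact

/-- The point `(1 - l) α(s) + l β(s)` of the interval `[α(s), β(s)]`. -/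
def Band.point (D : Band a) (s : Set.Icc (0 : ℝ) a) (l : unitInterval) : Set.Icc (0 : ℝ) a :=
  ⟨(D.lower s : ℝ) + l * ((D.upper s : ℝ) - D.lower s), by
    have h : (D.lower s : ℝ) ≤ D.upper s := D.lower_le_upper s
    have h1 := (D.lower s).2.1
    have h2 := (D.upper s).2.2
    have h3 := l.2.1
    have h4 := l.2.2
    constructor <;> nlinarith⟩

theorem Band.point_mem (D : Band a) (s : Set.Icc (0 : ℝ) a) (l : unitInterval) :
    (s, D.point s l) ∈ D.region := by
  have h : (D.lower s : ℝ) ≤ D.upper s := D.lower_le_upper s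
  have h3 := l.2.1
  have h4 := l.2.2
  constructor
  · change (D.lower s : ℝ) ≤ (D.lower s : ℝ) + l * ((D.upper s : ℝ) - D.lower s)
    nlinarith
  · change (D.lower s : ℝ) + l * ((D.upper s : ℝ) - D.lower s) ≤ (D.upper s : ℝ)
    nlinarith

theorem Band.exists_point (D : Band a) {s t : Set.Icc (0 : ℝ) a} (h : (s, t) ∈ D.region) :
    ∃ l, D.point s l = t := by
  have h1 : (D.lower s : ℝ) ≤ t := h.1
  have h2 : (t : ℝ) ≤ D.upper s := h.2
  rcases eq_or_lt_of_le (h1.trans h2) with he | hlt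
  · exact ⟨0, Subtype.ext (by simp only [Band.point]; simp; linarith)⟩
  · refine ⟨⟨((t : ℝ) - D.lower s) / ((D.upper s : ℝ) - D.lower s), ?_, ?_⟩, Subtype.ext ?_⟩
    · exact div_nonneg (by linarith) (by linarith)
    · rw [div_le_one (by linarith)]; linarith
    · have : (D.upper s : ℝ) - D.lower s ≠ 0 := by linarith
      simp only [Band.point]
      field_simp
      ring

/-- The values `k(s, t) x(t)`, `t ∈ [α(s), β(s)]`. -/
def Band.Kernel.values (k : D.Kernel) (x : PosCone C(Set.Icc (0 : ℝ) a, ℝ))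
    (s : Set.Icc (0 : ℝ) a) : Set ℝ :=
  {v | ∃ (t : Set.Icc (0 : ℝ) a) (h : (s, t) ∈ D.region), v = (k ⟨(s, t), h⟩ : ℝ) * x.1 t}

theorem Band.Kernel.values_eq (k : D.Kernel) (x : PosCone C(Set.Icc (0 : ℝ) a, ℝ))
    (s : Set.Icc (0 : ℝ) a) :
    k.values x s = (fun l : unitInterval =>
      (k ⟨(s, D.point s l), D.point_mem s l⟩ : ℝ) * x.1 (D.point s l)) '' Set.univ := by
  ext v
  constructor
  · rintro ⟨t, h, rfl⟩
    obtain ⟨l, rfl⟩ := D.exists_point h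
    exact ⟨l, trivial, rfl⟩
  · rintro ⟨l, -, rfl⟩
    exact ⟨_, D.point_mem s l, rfl⟩

theorem Band.Kernel.continuous_param (k : D.Kernel) (x : PosCone C(Set.Icc (0 : ℝ) a, ℝ)) :
    Continuous fun p : Set.Icc (0 : ℝ) a × unitInterval =>
      (k ⟨(p.1, D.point p.1 p.2), D.point_mem p.1 p.2⟩ : ℝ) * x.1 (D.point p.1 p.2) := by
  have hp : Continuous fun p : Set.Icc (0 : ℝ) a × unitInterval => D.point p.1 p.2 := by
    unfold Band.point
    fun_prop
  exact (NNReal.continuous_coe.comp (k.continuous.comp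
    ((continuous_fst.prodMk hp).subtype_mk _))).mul (x.1.continuous.comp hp)

theorem Band.Kernel.isCompact_values (k : D.Kernel) (x : PosCone C(Set.Icc (0 : ℝ) a, ℝ))
    (s : Set.Icc (0 : ℝ) a) : IsCompact (k.values x s) := by
  rw [k.values_eq]
  exact isCompact_univ.image ((k.continuous_param x).comp (Continuous.prodMk_right s))

theorem Band.Kernel.nonempty_values (k : D.Kernel) (x : PosCone C(Set.Icc (0 : ℝ) a, ℝ))
    (s : Set.Icc (0 : ℝ) a) : (k.values x s).Nonempty :=
  ⟨_, D.point s 0, D.point_mem s 0, rfl⟩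

/-- The operator `(A x)(s) = max {k(s, t) x(t) : α(s) ≤ t ≤ β(s)}` on the nonnegative continuous
functions on `[0, a]`; see `maxOp_isGreatest`. -/
def maxOp (k : D.Kernel) : Function.End (PosCone C(Set.Icc (0 : ℝ) a, ℝ)) := fun x =>
  ⟨⟨fun s => sSup (k.values x s), by
      simp_rw [k.values_eq]
      exact IsCompact.continuous_sSup isCompact_univ (k.continuous_param x)⟩,
    fun s => Real.sSup_nonneg (by
      rintro _ ⟨t, h, rfl⟩
      exact mul_nonneg (k _).2 (x.2 t))⟩

theorem maxOp_isGreatest (k : D.Kernel) (x : PosCone C(Set.Icc (0 : ℝ) a, ℝ))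
    (s : Set.Icc (0 : ℝ) a) :
    IsGreatest {v | ∃ (t : Set.Icc (0 : ℝ) a) (h : (s, t) ∈ D.region),
      v = (k ⟨(s, t), h⟩ : ℝ) * x.1 t} ((maxOp k x).1 s) :=
  (k.isCompact_values x s).isGreatest_sSup (k.nonempty_values x s)

open scoped Classical in
/-- A kernel on `S`, extended by `0` to a bounded kernel on `[0, a] × [0, a]`. -/
def Band.Kernel.extend (k : D.Kernel) : BddKernel (Set.Icc (0 : ℝ) a) :=
  ⟨fun s t => if h : (s, t) ∈ D.region then k ⟨(s, t), h⟩ else 0, by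
    obtain ⟨b, hb⟩ := (isCompact_range k.continuous).bddAbove
    refine ⟨b, fun s t => ?_⟩
    dsimp only
    split_ifs with h
    · exact hb ⟨_, rfl⟩
    · exact zero_le⟩

/-- `K` is a kernel of the self-map `T` of the cone of nonnegative continuous functions:
`(T x)(s) = sup {K(s, t) x(t) : t ∈ [0, a]}`. -/
def HasKernel (T : Function.End (PosCone C(Set.Icc (0 : ℝ) a, ℝ)))
    (K : BddKernel (Set.Icc (0 : ℝ) a)) : Prop :=
  ∀ x s, (T x).1 s = ⨆ t, (K.1 s t : ℝ) * x.1 t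

/-- The inclusion of the nonnegative continuous functions into the nonnegative bounded ones. -/
def toBdd (x : PosCone C(Set.Icc (0 : ℝ) a, ℝ)) : PosCone (BddFun (Set.Icc (0 : ℝ) a)) :=
  ⟨@BoundedContinuousFunction.ofNormedAddCommGroup (Set.Icc (0 : ℝ) a) ℝ ⊥ _ x.1 continuous_bot
    ‖x.1‖ x.1.norm_coe_le_norm, x.2⟩

theorem hasKernel_iff {T : Function.End (PosCone C(Set.Icc (0 : ℝ) a, ℝ))}
    {K : BddKernel (Set.Icc (0 : ℝ) a)} :
    HasKernel T K ↔ ∀ x, toBdd (T x) = supOp K (toBdd x) := by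
  constructor
  · intro h x
    apply Subtype.ext
    apply @BoundedContinuousFunction.ext _ ℝ ⊥ _
    intro s
    exact h x s
  · intro h x s
    have := congrArg (fun f => f.1 s) (h x)
    exact this

theorem HasKernel.mul {T U : Function.End (PosCone C(Set.Icc (0 : ℝ) a, ℝ))}
    {K H : BddKernel (Set.Icc (0 : ℝ) a)} (hT : HasKernel T K) (hU : HasKernel U H) :
    HasKernel (T * U) (kernelComp K H) := by
  rw [hasKernel_iff] at *
  intro x
  rw [supOp_kernelComp]
  change toBdd (T (U x)) = supOp K (supOp H (toBdd x))
  rw [hT, hU]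

theorem hasKernel_maxOp (k : D.Kernel) : HasKernel (maxOp k) k.extend := by
  intro x s
  have : Nonempty (Set.Icc (0 : ℝ) a) := ⟨s⟩
  have hg := maxOp_isGreatest k x s
  obtain ⟨t₀, h₀, e₀⟩ := hg.1
  have h0 : 0 ≤ (maxOp k x).1 s := (maxOp k x).2 s
  have hle : ∀ t, (k.extend.1 s t : ℝ) * x.1 t ≤ (maxOp k x).1 s := by
    intro t
    by_cases h : (s, t) ∈ D.region
    · exact hg.2 ⟨t, h, by simp [Band.Kernel.extend, h]⟩
    · simpa [Band.Kernel.extend, h] using h0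
  apply le_antisymm
  · refine le_ciSup_of_le ⟨_, by rintro _ ⟨t, rfl⟩; exact hle t⟩ t₀ ?_
    rw [e₀]
    simp [Band.Kernel.extend, h₀]
  · exact ciSup_le hle

/-- A product of max-type kernel operators has as its kernel the product of the kernels. -/
theorem hasKernel_prod (l : List D.Kernel) :
    HasKernel (l.map maxOp).prod (kernelProd (l.map Band.Kernel.extend)) := by
  induction l with
  | nil =>
    rw [hasKernel_iff]
    intro x
    change toBdd x = supOp kernelId (toBdd x)
    rw [supOp_kernelId]
    rfl
  | cons k l ih => exact (hasKernel_maxOp k).mul ih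

end Continuous

end

/-! ### Kernels under the sup-product and the Hadamard product. -/

section KernelAlgebra

variable {M : Type*}

/-! The polynomial plays almost no role. For sup-kernel operators there is a spectral mapping
theorem, `r(q_∨(A)) = ⋁ α_j r(A)^j` (`bonsallRadius_maxPoly_supOp`), and the right-hand side is
increasing in `r(A)`. Moreover `q^{[m]}` evaluated at `x^m`, followed by the `m`-th root, gives back
the value of `q` at `x` (`maxPolyVal_coeffPow`). The first chain therefore reduces to `r(A₁ ∘ ⋯ ∘
A_m)^m ≤ r(P₁ ∘ ⋯ ∘ P_m) ≤ r(A₁ ⋯ A_m)^m`.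

For the left half, a product of Hadamard products is dominated entrywise by the Hadamard product of
the products. Writing the `j`-th factor of `(A₁ ∘ ⋯ ∘ A_m)^m` with its entries cyclically shifted by
`j` makes the products on the dominating side exactly the `P_i` (`kernelPow_prod_le_prod_rotate`);
then `r(A)^m ≤ r(A^m)` applies. For the right half, the radius is submultiplicative under Hadamard
products, and all `P_i` have the same radius because `r(AB) = r(BA)`. The last inequality is the
two-factor case for the pair `AB`, `BA`, since `AB·BA` is a cyclic shift of `A²B²`.

All estimates of radii are made on kernels: the norm of a sup-kernel operator is the supremum of its
kernel, as the constant function `1` shows, so `r(A)` is governed by the rates `R` for which the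
entries of the powers are at most `c R^n` (`KernelGrowth`). The function `1` is also continuous, so
a map on the cone of `C[0, a]` with kernel `K` has the same norm and radius as `supOp K`; this
reduces class (II) to class (I) (`HasKernel.bonsallRadius_eq`). -/

/-- The power of a kernel with respect to `kernelComp`. -/
noncomputable def kernelPow (K : BddKernel M) (n : ℕ) : BddKernel M := kernelProd (List.replicate n K)

theorem kernelPow_zero (K : BddKernel M) : kernelPow K 0 = kernelId := rfl

theorem kernelPow_succ (K : BddKernel M) (n : ℕ) :
    kernelPow K (n + 1) = kernelComp K (kernelPow K n) := rfl

theorem supOp_kernelPow (K : BddKernel M) (n : ℕ) : supOp (kernelPow K n) = supOp K ^ n := by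
  simp [kernelPow, supOp_kernelProd]

/-- As an operator determines its kernel, algebraic identities between kernels are checked on
operators, where they are identities in a monoid. The same device is used throughout. -/
theorem kernelPow_add (K : BddKernel M) (m n : ℕ) :
    kernelPow K (m + n) = kernelComp (kernelPow K m) (kernelPow K n) :=
  supOp_injective (by simp [supOp_kernelComp, supOp_kernelPow, pow_add])

theorem kernelPow_mul (K : BddKernel M) (m n : ℕ) :
    kernelPow K (m * n) = kernelPow (kernelPow K m) n :=
  supOp_injective (by simp [supOp_kernelPow, pow_mul])

theorem kernelProd_append (l l' : List (BddKernel M)) :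
    kernelProd (l ++ l') = kernelComp (kernelProd l) (kernelProd l') :=
  supOp_injective (by simp [supOp_kernelComp, supOp_kernelProd])

theorem kernelComp_bddAbove (k h : BddKernel M) (s u : M) :
    BddAbove (Set.range fun t => k.1 s t * h.1 t u) := by
  obtain ⟨b, hb⟩ := k.2
  obtain ⟨c, hc⟩ := h.2
  exact ⟨b * c, by rintro _ ⟨t, rfl⟩; exact mul_le_mul' (hb s t) (hc t u)⟩

theorem kernelComp_le_iff {k h : BddKernel M} {s u : M} {c : ℝ≥0} :
    (kernelComp k h).1 s u ≤ c ↔ ∀ t, k.1 s t * h.1 t u ≤ c :=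
  ciSup_le_iff' (kernelComp_bddAbove k h s u)

theorem le_kernelComp (k h : BddKernel M) (s t u : M) :
    k.1 s t * h.1 t u ≤ (kernelComp k h).1 s u :=
  kernelComp_le_iff.1 le_rfl t

theorem kernelComp_mono {k k' h h' : BddKernel M} (hk : k ≤ k') (hh : h ≤ h') :
    kernelComp k h ≤ kernelComp k' h' := fun s u =>
  kernelComp_le_iff.2 fun t =>
    (mul_le_mul' (hk s t) (hh t u)).trans (le_kernelComp k' h' s t u)

theorem kernelPow_mono {K L : BddKernel M} (h : K ≤ L) (n : ℕ) :
    kernelPow K n ≤ kernelPow L n := by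
  induction n with
  | zero => exact le_rfl
  | succ n ih => exact kernelComp_mono h ih

theorem BddKernel.prod_apply {ι : Type*} (S : Finset ι) (k : ι → BddKernel M) (s t : M) :
    (∏ i ∈ S, k i).1 s t = ∏ i ∈ S, (k i).1 s t := by
  simp [Finset.prod_apply]

theorem kernelComp_prod_le {ι : Type*} (S : Finset ι) (k h : ι → BddKernel M) :
    kernelComp (∏ i ∈ S, k i) (∏ i ∈ S, h i) ≤ ∏ i ∈ S, kernelComp (k i) (h i) := fun s u => by
  refine kernelComp_le_iff.2 fun t => ?_
  simp only [BddKernel.prod_apply, ← Finset.prod_mul_distrib]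
  exact Finset.prod_le_prod' fun i _ => le_kernelComp (k i) (h i) s t u

theorem kernelId_self (s : M) : (kernelId : BddKernel M).1 s s = 1 := by
  simp [kernelId]

theorem kernelId_of_ne {s t : M} (h : s ≠ t) : (kernelId : BddKernel M).1 s t = 0 := by
  simp [kernelId, h]

theorem kernelId_le_one (s t : M) : (kernelId : BddKernel M).1 s t ≤ 1 := by
  by_cases h : s = t
  · rw [h, kernelId_self]
  · rw [kernelId_of_ne h]; exact zero_le

/-- A product of Hadamard products is dominated by the Hadamard product of the products. -/
theorem kernelProd_prod_le {ι : Type*} (S : Finset ι) (l : List (ι → BddKernel M)) :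
    kernelProd (l.map fun g => ∏ i ∈ S, g i) ≤ ∏ i ∈ S, kernelProd (l.map fun g => g i) := by
  induction l with
  | nil =>
    intro s t
    rw [BddKernel.prod_apply]
    -- Only an inequality: for empty `S` the right side is the constant `1`.
    change (kernelId : BddKernel M).1 s t ≤ ∏ i ∈ S, (kernelId : BddKernel M).1 s t
    by_cases h : s = t
    · simp [h, kernelId_self]
    · rw [kernelId_of_ne h]; exact zero_le
  | cons g l ih => exact (kernelComp_mono le_rfl ih).trans (kernelComp_prod_le S _ _)

theorem kernelPow_prod_le {ι : Type*} (S : Finset ι) (k : ι → BddKernel M) (n : ℕ) :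
    kernelPow (∏ i ∈ S, k i) n ≤ ∏ i ∈ S, kernelPow (k i) n := by
  simpa [kernelPow] using kernelProd_prod_le S (List.replicate n k)

/-- The power `(k₁ ∘ ⋯ ∘ k_m) ^ m` is dominated by the Hadamard product of the cyclic products. -/
theorem kernelPow_prod_le_prod_rotate {m : ℕ} (k : Fin m → BddKernel M) :
    kernelPow (∏ i, k i) m ≤ ∏ i : Fin m, kernelProd ((List.ofFn k).rotate i) := by
  rcases Nat.eq_zero_or_pos m with rfl | hm
  · intro s t
    simpa [kernelPow_zero] using kernelId_le_one s t
  have : NeZero m := ⟨hm.ne'⟩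
  -- Consider the `m × m` array `k (j + i)`, indices modulo `m`. The Hadamard product over `i` for
  -- fixed `j` is always `∏ i, k i` (`h1`); reading over `j` for fixed `i` gives the list rotated by
  -- `i` (`h2`).
  have h := kernelProd_prod_le Finset.univ (List.ofFn fun j : Fin m => fun i : Fin m => k (j + i))
  have h1 : (List.ofFn fun j : Fin m => fun i : Fin m => k (j + i)).map (fun g => ∏ i, g i) =
      List.replicate m (∏ i, k i) := by
    rw [List.map_ofFn, ← List.ofFn_const]
    congr 1
    funext j
    exact Fintype.prod_equiv (Equiv.addLeft j) _ _ fun i => rfl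
  have h2 : ∀ i : Fin m, (List.ofFn fun j : Fin m => fun i : Fin m => k (j + i)).map (fun g => g i) =
      (List.ofFn k).rotate i := by
    intro i
    rw [List.map_ofFn]
    refine List.ext_getElem (by simp) fun n hn hn' => ?_
    simp only [List.getElem_ofFn, List.getElem_rotate, Function.comp]
    congr 1
    ext
    simp [Fin.val_add]
  rw [h1] at h
  simpa only [h2, kernelPow] using h

end KernelAlgebra

/-! ### Growth rates of the powers of a kernel. -/

section Growth

variable {M : Type*}

/-- The powers of `K` grow at most like `R ^ n`. -/
def KernelGrowth (K : BddKernel M) (R : ℝ≥0) : Prop :=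
  ∃ c : ℝ≥0, ∀ n s t, (kernelPow K n).1 s t ≤ c * R ^ n

theorem KernelGrowth.mono {K L : BddKernel M} {R : ℝ≥0} (h : K ≤ L) (hL : KernelGrowth L R) :
    KernelGrowth K R := by
  obtain ⟨c, hc⟩ := hL
  exact ⟨c, fun n s t => (kernelPow_mono h n s t).trans (hc n s t)⟩

theorem exists_kernelGrowth (K : BddKernel M) : ∃ R, 0 < R ∧ KernelGrowth K R := by
  obtain ⟨b, hb⟩ := K.2
  refine ⟨b + 1, by positivity, 1, fun n => ?_⟩
  induction n with
  | zero => intro s t; simpa [kernelPow_zero] using kernelId_le_one s t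
  | succ n ih =>
    intro s t
    rw [kernelPow_succ, kernelComp_le_iff]
    intro u
    calc K.1 s u * (kernelPow K n).1 u t ≤ (b + 1) * (1 * (b + 1) ^ n) :=
          mul_le_mul' ((hb s u).trans (by simp)) (ih u t)
      _ = 1 * (b + 1) ^ (n + 1) := by ring

/-- Division of `n` by `j` with remainder: the multiple of `j` is controlled by the hypothesis, and
the remaining fewer than `j` factors by any crude growth bound. The sum in the constant dominates
the contribution of every possible remainder. -/
theorem KernelGrowth.of_pow {K : BddKernel M} {j : ℕ} (hj : j ≠ 0) {R : ℝ≥0} (hR : 0 < R)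
    (h : KernelGrowth (kernelPow K j) (R ^ j)) : KernelGrowth K R := by
  obtain ⟨c, hc⟩ := h
  obtain ⟨b, -, d, hd⟩ := exists_kernelGrowth K
  refine ⟨c * ∑ i ∈ Finset.range j, d * b ^ i / R ^ i, fun n s t => ?_⟩
  have hn : n = j * (n / j) + n % j := (Nat.div_add_mod n j).symm
  have hlt : n % j < j := Nat.mod_lt _ (Nat.pos_of_ne_zero hj)
  conv_lhs => rw [hn, kernelPow_add, kernelPow_mul]
  conv_rhs => rw [hn, pow_add, pow_mul]
  rw [kernelComp_le_iff]
  intro u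
  have h1 : d * b ^ (n % j) ≤ (∑ i ∈ Finset.range j, d * b ^ i / R ^ i) * R ^ (n % j) := by
    rw [← div_le_iff₀ (by positivity)]
    exact Finset.single_le_sum (f := fun i => d * b ^ i / R ^ i) (fun _ _ => zero_le)
      (Finset.mem_range.2 hlt)
  calc _ ≤ (c * (R ^ j) ^ (n / j)) * (d * b ^ (n % j)) := mul_le_mul' (hc _ s u) (hd _ u t)
    _ ≤ (c * (R ^ j) ^ (n / j)) * ((∑ i ∈ Finset.range j, d * b ^ i / R ^ i) * R ^ (n % j)) := by
        gcongr
    _ = _ := by ring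

theorem KernelGrowth.comp_comm {K L : BddKernel M} {R : ℝ≥0} (hR : 0 < R)
    (h : KernelGrowth (kernelComp K L) R) : KernelGrowth (kernelComp L K) R := by
  obtain ⟨c, hc⟩ := h
  obtain ⟨b, hb⟩ := K.2
  obtain ⟨d, hd⟩ := L.2
  -- The summand `1` serves `n = 0`. The other comes from `(LK)^(n+1) = L (KL)^n K`, where division
  -- by `R` makes up for the missing factor of `R^(n+1)`.
  refine ⟨1 + d * (c * b) / R, fun n => ?_⟩
  rcases n with _ | n
  · intro s t
    simpa [kernelPow_zero] using (kernelId_le_one s t).trans (by simp)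
  · intro s t
    have e : kernelPow (kernelComp L K) (n + 1) =
        kernelComp L (kernelComp (kernelPow (kernelComp K L) n) K) :=
      supOp_injective (by
        simp only [supOp_kernelComp, supOp_kernelPow]
        rw [pow_succ', mul_assoc, mul_pow_mul])
    rw [e, kernelComp_le_iff]
    intro u
    have h1 : (kernelComp (kernelPow (kernelComp K L) n) K).1 u t ≤ c * R ^ n * b :=
      kernelComp_le_iff.2 fun v => mul_le_mul' (hc n u v) (hb v t)
    calc _ ≤ d * (c * R ^ n * b) := mul_le_mul' (hd s u) h1
      _ = (d * (c * b) / R) * R ^ (n + 1) := by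
        rw [pow_succ]
        field_simp
      _ ≤ _ := by gcongr; simp

theorem KernelGrowth.prod {ι : Type*} [Fintype ι] {k : ι → BddKernel M} {R : ℝ≥0}
    (h : ∀ i, KernelGrowth (k i) R) : KernelGrowth (∏ i, k i) (R ^ Fintype.card ι) := by
  choose c hc using h
  refine ⟨∏ i, c i, fun n s t => (kernelPow_prod_le _ k n s t).trans ?_⟩
  rw [BddKernel.prod_apply]
  calc _ ≤ ∏ i, c i * R ^ n := Finset.prod_le_prod' fun i _ => hc i n s t
    _ = _ := by
      rw [Finset.prod_mul_distrib, Finset.prod_const, Finset.card_univ, ← pow_mul, ← pow_mul,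
        mul_comm n]

theorem NNReal.le_of_forall_pow_le_const_mul {x R c : ℝ≥0} (hR : 0 < R)
    (h : ∀ n : ℕ, x ^ n ≤ c * R ^ n) : x ≤ R := by
  by_contra! hlt
  have h1 : 1 < x / R := (one_lt_div₀ hR).2 hlt
  obtain ⟨n, hn⟩ := pow_unbounded_of_one_lt c h1
  rw [div_pow, lt_div_iff₀ (by positivity)] at hn
  exact absurd (h n) hn.not_ge

/-- The diagonal entries of all powers of the identity are `1`, and nonemptiness supplies one such
entry. This settles the constant coefficient in the spectral mapping theorem. -/
theorem KernelGrowth.one_le_of_kernelId [Nonempty M] {R : ℝ≥0} (hR : 0 < R)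
    (h : KernelGrowth (kernelId : BddKernel M) R) : 1 ≤ R := by
  obtain ⟨c, hc⟩ := h
  refine NNReal.le_of_forall_pow_le_const_mul (c := c) hR fun n => ?_
  obtain ⟨s⟩ := ‹Nonempty M›
  have e : kernelPow (kernelId : BddKernel M) n = kernelId :=
    supOp_injective (by simp [supOp_kernelPow, supOp_kernelId])
  have := hc n s s
  rwa [e, kernelId_self, ← one_pow n] at this

end Growth

/-! ### The spectral radius in terms of growth rates. -/

section SupOpRadius

variable {M : Type*}

/-- The constant function `1`. -/
noncomputable def BddFun.one (M : Type*) : PosCone (BddFun M) :=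
  ⟨@BoundedContinuousFunction.const M ℝ ⊥ _ 1, fun _ => zero_le_one⟩

theorem supOp_apply_le_iff (K : BddKernel M) (f : PosCone (BddFun M)) (s : M) {c : ℝ} :
    (supOp K f).1 s ≤ c ↔ ∀ t, (K.1 s t : ℝ) * f.1 t ≤ c := by
  have : Nonempty M := ⟨s⟩
  rw [supOp_apply, ciSup_le_iff (BddKernel.bddAbove K f s)]

theorem BddFun.norm_le_of_forall_le {f : PosCone (BddFun M)} {c : ℝ} (hc : 0 ≤ c)
    (h : ∀ s, f.1 s ≤ c) : ‖f.1‖ ≤ c := by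
  refine (@BoundedContinuousFunction.norm_le M ℝ ⊥ _ f.1 c hc).2 fun s => ?_
  rw [Real.norm_of_nonneg (show 0 ≤ f.1 s from f.2 s)]
  exact h s

theorem coneNorm_supOp_le {K : BddKernel M} {c : ℝ≥0} (h : ∀ s t, K.1 s t ≤ c) :
    coneNorm (supOp K) ≤ c := by
  refine iSup₂_le fun f hf => ?_
  rw [ENNReal.div_le_iff (by simpa using hf) (by simp)]
  have h1 : ‖(supOp K f).1‖ ≤ c * ‖f.1‖ := by
    refine BddFun.norm_le_of_forall_le (by positivity) fun s => ?_
    rw [supOp_apply_le_iff]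
    exact fun t => mul_le_mul (by exact_mod_cast h s t) (f.1.apply_le_norm t) (f.2 t) c.2
  have h2 : ‖(supOp K f).1‖₊ ≤ c * ‖f.1‖₊ := h1
  simp only [enorm_eq_nnnorm]
  exact_mod_cast h2

theorem supOp_zero (K : BddKernel M) (f : PosCone (BddFun M)) (hf : f.1 = 0) :
    (supOp K f).1 = 0 := by
  rw [← norm_le_zero_iff]
  refine BddFun.norm_le_of_forall_le le_rfl fun s => (supOp_apply_le_iff K f s).2 fun t => ?_
  rw [hf]
  simp

theorem coneNorm_supOp_ne_top (K : BddKernel M) : coneNorm (supOp K) ≠ ∞ := by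
  obtain ⟨b, hb⟩ := K.2
  exact ne_top_of_le_ne_top ENNReal.coe_ne_top (coneNorm_supOp_le hb)

/-- Every value of the kernel is bounded by the norm of the image of the constant function `1`. -/
theorem le_coneNorm_supOp (K : BddKernel M) (s t : M) : (K.1 s t : ℝ≥0∞) ≤ coneNorm (supOp K) := by
  have h1 : ‖(BddFun.one M).1‖ ≤ 1 := BddFun.norm_le_of_forall_le zero_le_one fun _ => le_rfl
  have h2 : (K.1 s t : ℝ) ≤ ‖(supOp K (BddFun.one M)).1‖ := by
    refine le_trans ?_ (BddFun.apply_le_norm _ s)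
    have := (supOp_apply_le_iff K (BddFun.one M) s).1 le_rfl t
    simpa [BddFun.one] using this
  have h3 : K.1 s t ≤ ‖(supOp K (BddFun.one M)).1‖₊ := h2
  have h4 : ‖(BddFun.one M).1‖₊ ≤ 1 := h1
  calc (K.1 s t : ℝ≥0∞) ≤ ‖(supOp K (BddFun.one M)).1‖ₑ := by
        rw [enorm_eq_nnnorm]; exact_mod_cast h3
    _ ≤ coneNorm (supOp K) * ‖(BddFun.one M).1‖ₑ := enorm_le_coneNorm_mul (supOp_zero K) _
    _ ≤ coneNorm (supOp K) * 1 := by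
        gcongr
        rw [enorm_eq_nnnorm]; exact_mod_cast h4
    _ = _ := mul_one _

theorem bonsallRadius_supOp_le {K : BddKernel M} {R : ℝ≥0} (h : KernelGrowth K R) :
    bonsallRadius (supOp K) ≤ R := by
  obtain ⟨c, hc⟩ := h
  -- With `c + 1` in place of `c` the base is nonzero, so its `n`-th roots tend to `1`.
  have ht : Tendsto (fun n : ℕ => ((((c + 1) ^ (1 / (n : ℝ)) * R : ℝ≥0)) : ℝ≥0∞)) atTop (𝓝 R) := by
    refine ENNReal.tendsto_coe.2 ?_
    have h1 : Tendsto (fun n : ℕ => (c + 1) ^ (1 / (n : ℝ))) atTop (𝓝 ((c + 1) ^ (0 : ℝ))) :=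
      tendsto_const_nhds.nnrpow tendsto_one_div_atTop_nhds_zero_nat (Or.inl (by positivity))
    simpa using h1.mul_const R
  refine le_of_tendsto_of_tendsto
    (tendsto_bonsallRadius (supOp_zero K) (coneNorm_supOp_ne_top K)).1 ht ?_
  filter_upwards [eventually_ne_atTop 0] with n hn
  have h1 : coneNorm (supOp K ^ n) ≤ (((c + 1) * R ^ n : ℝ≥0) : ℝ≥0∞) := by
    rw [← supOp_kernelPow]
    refine coneNorm_supOp_le fun s t => (hc n s t).trans ?_
    gcongr
    simp
  calc _ ≤ (((c + 1) * R ^ n : ℝ≥0) : ℝ≥0∞) ^ (1 / (n : ℝ)) := by gcongr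
    _ = _ := by
      rw [← ENNReal.coe_rpow_of_nonneg _ (by positivity), NNReal.mul_rpow, one_div,
        NNReal.pow_rpow_inv_natCast _ hn]

/-- The radius is an infimum, so some single `j ≥ 1` has `‖A^j‖ ≤ R^j`. Then the powers of `A^j`
grow at rate `R^j` with constant `1`, and `KernelGrowth.of_pow` descends to `A`. -/
theorem kernelGrowth_of_bonsallRadius_lt {K : BddKernel M} {R : ℝ≥0}
    (h : bonsallRadius (supOp K) < R) : KernelGrowth K R := by
  have hR : 0 < R := by exact_mod_cast (zero_le.trans_lt h)
  rw [(tendsto_bonsallRadius (supOp_zero K) (coneNorm_supOp_ne_top K)).2] at h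
  obtain ⟨j, hj, hlt⟩ : ∃ n : ℕ, n ≠ 0 ∧ coneNorm (supOp K ^ n) ^ (1 / (n : ℝ)) < R := by
    simpa [iInf_lt_iff] using h
  have hle : coneNorm (supOp K ^ j) ≤ ((R ^ j : ℝ≥0) : ℝ≥0∞) := by
    rw [one_div] at hlt
    have := (ENNReal.rpow_inv_le_iff (by positivity)).1 hlt.le
    rwa [ENNReal.rpow_natCast, ← ENNReal.coe_pow] at this
  refine KernelGrowth.of_pow hj hR ⟨1, fun n => ?_⟩
  induction n with
  | zero => intro s t; simpa [kernelPow_zero] using kernelId_le_one s t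
  | succ n ih =>
    intro s t
    rw [kernelPow_succ, kernelComp_le_iff]
    intro u
    have h1 : (kernelPow K j).1 s u ≤ R ^ j := by
      have := (le_coneNorm_supOp (kernelPow K j) s u).trans (supOp_kernelPow K j ▸ hle)
      exact_mod_cast this
    calc _ ≤ R ^ j * (1 * (R ^ j) ^ n) := mul_le_mul' h1 (ih u t)
      _ = _ := by ring

theorem bonsallRadius_supOp_ne_top (K : BddKernel M) : bonsallRadius (supOp K) ≠ ∞ := by
  obtain ⟨R, -, h⟩ := exists_kernelGrowth K
  exact ne_top_of_le_ne_top ENNReal.coe_ne_top (bonsallRadius_supOp_le h)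

theorem ENNReal.le_apply_of_forall_nnreal_lt {f : ℝ≥0∞ → ℝ≥0∞} (hf : Continuous f) {x a : ℝ≥0∞}
    (hx : x ≠ ∞) (h : ∀ R : ℝ≥0, x < R → a ≤ f R) : a ≤ f x := by
  -- The bound is carried to `x` by a limit from the right, which exists because `x` is finite.
  have : (𝓝[>] x).NeBot := nhdsGT_neBot_of_exists_gt ⟨∞, hx.lt_top⟩
  refine ge_of_tendsto (hf.tendsto x |>.mono_left nhdsWithin_le_nhds : Tendsto f (𝓝[>] x) _) ?_
  filter_upwards [Ioo_mem_nhdsGT hx.lt_top] with y hy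
  lift y to ℝ≥0 using hy.2.ne
  exact h y hy.1

/-- To bound a function of the spectral radius it suffices to bound it at all growth rates. -/
theorem le_apply_bonsallRadius {f : ℝ≥0∞ → ℝ≥0∞} (hf : Continuous f) {K : BddKernel M} {a : ℝ≥0∞}
    (h : ∀ R : ℝ≥0, 0 < R → KernelGrowth K R → a ≤ f R) : a ≤ f (bonsallRadius (supOp K)) :=
  ENNReal.le_apply_of_forall_nnreal_lt hf (bonsallRadius_supOp_ne_top K) fun R hR =>
    h R (by exact_mod_cast (zero_le.trans_lt hR)) (kernelGrowth_of_bonsallRadius_lt hR)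

theorem bonsallRadius_supOp_mono {K L : BddKernel M} (h : K ≤ L) :
    bonsallRadius (supOp K) ≤ bonsallRadius (supOp L) :=
  le_apply_bonsallRadius continuous_id fun _ _ hL => bonsallRadius_supOp_le (hL.mono h)

theorem bonsallRadius_supOp_comp_comm (K L : BddKernel M) :
    bonsallRadius (supOp (kernelComp K L)) = bonsallRadius (supOp (kernelComp L K)) :=
  le_antisymm
    (le_apply_bonsallRadius continuous_id fun _ hR h => bonsallRadius_supOp_le (h.comp_comm hR))
    (le_apply_bonsallRadius continuous_id fun _ hR h => bonsallRadius_supOp_le (h.comp_comm hR))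

theorem bonsallRadius_kernelProd_rotate (l : List (BddKernel M)) (i : ℕ) :
    bonsallRadius (supOp (kernelProd (l.rotate i))) = bonsallRadius (supOp (kernelProd l)) := by
  rw [List.rotate_eq_drop_append_take_mod, kernelProd_append, bonsallRadius_supOp_comp_comm,
    ← kernelProd_append, List.take_append_drop]

theorem pow_bonsallRadius_le [Nonempty M] (K : BddKernel M) (j : ℕ) :
    bonsallRadius (supOp K) ^ j ≤ bonsallRadius (supOp (kernelPow K j)) := by
  refine le_apply_bonsallRadius continuous_id fun R hR h => ?_
  rcases eq_or_ne j 0 with rfl | hj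
  · rw [pow_zero]
    exact ENNReal.one_le_coe_iff.2 (KernelGrowth.one_le_of_kernelId hR h)
  · have e : (R ^ (j⁻¹ : ℝ)) ^ j = R := NNReal.rpow_inv_natCast_pow R hj
    rw [← e] at h
    have h1 := bonsallRadius_supOp_le (h.of_pow hj (NNReal.rpow_pos hR))
    calc bonsallRadius (supOp K) ^ j ≤ ((R ^ (j⁻¹ : ℝ) : ℝ≥0) : ℝ≥0∞) ^ j := by gcongr
      _ = R := by rw [← ENNReal.coe_pow, e]

/-- Any `R` above the common radius is a growth rate of every factor, and growth rates multiply
under Hadamard products by `kernelPow_prod_le`. It is applied to the cyclic products, whose radii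
agree. -/
theorem bonsallRadius_prod_le {ι : Type*} [Fintype ι] {k : ι → BddKernel M} {L : BddKernel M}
    (h : ∀ i, bonsallRadius (supOp (k i)) = bonsallRadius (supOp L)) :
    bonsallRadius (supOp (∏ i, k i)) ≤ bonsallRadius (supOp L) ^ Fintype.card ι := by
  refine ENNReal.le_apply_of_forall_nnreal_lt (ENNReal.continuous_pow _) (bonsallRadius_supOp_ne_top L)
    fun R hR => ?_
  have h1 := bonsallRadius_supOp_le
    (KernelGrowth.prod fun i => kernelGrowth_of_bonsallRadius_lt ((h i).trans_lt hR))
  exact_mod_cast h1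

end SupOpRadius

/-! ### Maxpolynomials and the spectral mapping theorem. -/

section MaxPolyKernel

variable {M : Type*}

/-- The kernel of the maxpolynomial `q_∨` of the operator with kernel `K`. -/
noncomputable def polyKernel (q : Polynomial ℝ≥0) (K : BddKernel M) : BddKernel M :=
  ⟨fun s t => (Finset.range (q.natDegree + 1)).sup fun j => q.coeff j * (kernelPow K j).1 s t, by
    choose b hb using fun j => (kernelPow K j).2
    refine ⟨(Finset.range (q.natDegree + 1)).sup fun j => q.coeff j * b j, fun s t => ?_⟩
    exact Finset.sup_mono_fun fun j _ => mul_le_mul' le_rfl (hb j s t)⟩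

theorem coeff_mul_le_polyKernel (q : Polynomial ℝ≥0) (K : BddKernel M) (j : ℕ) (s t : M) :
    q.coeff j * (kernelPow K j).1 s t ≤ (polyKernel q K).1 s t := by
  by_cases hj : j < q.natDegree + 1
  · exact Finset.le_sup (f := fun j => q.coeff j * (kernelPow K j).1 s t) (Finset.mem_range.2 hj)
  · rw [Polynomial.coeff_eq_zero_of_natDegree_lt (by omega), zero_mul]
    exact zero_le

theorem polyKernel_le_iff {q : Polynomial ℝ≥0} {K : BddKernel M} {s t : M} {c : ℝ≥0} :
    (polyKernel q K).1 s t ≤ c ↔ ∀ j, q.coeff j * (kernelPow K j).1 s t ≤ c :=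
  ⟨fun h j => (coeff_mul_le_polyKernel q K j s t).trans h, fun h => Finset.sup_le fun j _ => h j⟩

/-- The value at a point of a function in the positive cone. -/
def BddFun.eval (s : M) (f : PosCone (BddFun M)) : ℝ≥0 := ⟨f.1 s, f.2 s⟩

theorem eval_supOp_le_iff {K : BddKernel M} {f : PosCone (BddFun M)} {s : M} {c : ℝ≥0} :
    BddFun.eval s (supOp K f) ≤ c ↔ ∀ t, K.1 s t * BddFun.eval t f ≤ c :=
  supOp_apply_le_iff K f s

theorem eval_maxPoly (q : Polynomial ℝ≥0) (A : Function.End (PosCone (BddFun M)))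
    (f : PosCone (BddFun M)) (s : M) :
    BddFun.eval s (maxPoly q A f) = (Finset.range (q.natDegree + 1)).sup fun j =>
      q.coeff j * BddFun.eval s ((A ^ j) f) :=
  Finset.apply_sup_eq_sup_comp (BddFun.eval s) (fun _ _ => rfl) rfl

theorem maxPoly_supOp (q : Polynomial ℝ≥0) (K : BddKernel M) :
    maxPoly q (supOp K) = supOp (polyKernel q K) := by
  funext f
  apply Subtype.ext
  apply @BoundedContinuousFunction.ext M ℝ ⊥ _
  intro s
  have : BddFun.eval s (maxPoly q (supOp K) f) = BddFun.eval s (supOp (polyKernel q K) f) := by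
    rw [eval_maxPoly]
    apply le_antisymm
    · refine Finset.sup_le fun j _ => ?_
      rw [← supOp_kernelPow]
      rcases eq_or_ne (q.coeff j) 0 with h0 | h0
      · rw [h0, zero_mul]; exact zero_le
      -- Dividing by the coefficient isolates the supremum, so that it can be bounded termwise.
      -- Later proofs treat suprema inside products in the same way.
      rw [mul_comm, ← le_div_iff₀ (pos_iff_ne_zero.2 h0), eval_supOp_le_iff]
      intro t
      rw [le_div_iff₀ (pos_iff_ne_zero.2 h0)]
      calc _ = q.coeff j * (kernelPow K j).1 s t * BddFun.eval t f := by ring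
        _ ≤ (polyKernel q K).1 s t * BddFun.eval t f :=
            mul_le_mul' (coeff_mul_le_polyKernel q K j s t) le_rfl
        _ ≤ _ := eval_supOp_le_iff.1 le_rfl t
    · rw [eval_supOp_le_iff]
      intro t
      simp only [polyKernel]
      rw [NNReal.finset_sup_mul]
      refine Finset.sup_mono_fun fun j _ => ?_
      rw [mul_assoc, ← supOp_kernelPow]
      exact mul_le_mul' le_rfl (eval_supOp_le_iff.1 le_rfl t)
  exact congrArg NNReal.toReal this

theorem coeff_pow_mul_le_kernelPow_polyKernel (q : Polynomial ℝ≥0) (K : BddKernel M) (j n : ℕ)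
    (s t : M) : q.coeff j ^ n * (kernelPow (kernelPow K j) n).1 s t ≤
      (kernelPow (polyKernel q K) n).1 s t := by
  induction n generalizing s with
  | zero => simp [kernelPow_zero]
  | succ n ih =>
    rw [kernelPow_succ, kernelPow_succ]
    rcases eq_or_ne (q.coeff j) 0 with h0 | h0
    · simp [h0]
    have hpos : 0 < q.coeff j ^ (n + 1) := pow_pos (pos_iff_ne_zero.2 h0) _
    rw [mul_comm, ← le_div_iff₀ hpos, kernelComp_le_iff]
    intro u
    rw [le_div_iff₀ hpos]
    calc _ = (q.coeff j * (kernelPow K j).1 s u) *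
          (q.coeff j ^ n * (kernelPow (kernelPow K j) n).1 u t) := by ring
      _ ≤ _ := mul_le_mul' (coeff_mul_le_polyKernel q K j s u) (ih u)
      _ ≤ _ := le_kernelComp _ _ s u t

/-- This is the upper half of spectral mapping. The induction carries a spare factor `K^N`:
expanding one factor `q_∨(K)` into its terms `α_j K^j` turns `K^N` into `K^(j+N)` at cost `α_j R^j ≤
Q`, so the full `n`-fold expansion is never written out. -/
theorem kernelGrowth_polyKernel {q : Polynomial ℝ≥0} {K : BddKernel M} {R Q : ℝ≥0}
    (h : KernelGrowth K R) (hQ : ∀ j, q.coeff j * R ^ j ≤ Q) : KernelGrowth (polyKernel q K) Q := by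
  obtain ⟨c, hc⟩ := h
  have key : ∀ n N s t, (kernelComp (kernelPow (polyKernel q K) n) (kernelPow K N)).1 s t ≤
      c * Q ^ n * R ^ N := by
    intro n
    induction n with
    | zero =>
      intro N s t
      have e : kernelComp (kernelPow (polyKernel q K) 0) (kernelPow K N) = kernelPow K N :=
        supOp_injective (by simp [supOp_kernelComp, supOp_kernelPow])
      simpa [e] using hc N s t
    | succ n ih =>
      intro N s t
      have e : kernelComp (kernelPow (polyKernel q K) (n + 1)) (kernelPow K N) =
          kernelComp (kernelPow (polyKernel q K) n) (kernelComp (polyKernel q K) (kernelPow K N)) :=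
        supOp_injective (by simp [supOp_kernelComp, supOp_kernelPow, pow_succ, mul_assoc])
      rw [e, kernelComp_le_iff]
      intro u
      rcases eq_or_ne ((kernelPow (polyKernel q K) n).1 s u) 0 with h0 | h0
      · rw [h0, zero_mul]; exact zero_le
      rw [mul_comm, ← le_div_iff₀ (pos_iff_ne_zero.2 h0), kernelComp_le_iff]
      intro v
      rcases eq_or_ne ((kernelPow K N).1 v t) 0 with h1 | h1
      · rw [h1, mul_zero]; exact zero_le
      rw [← le_div_iff₀ (pos_iff_ne_zero.2 h1), polyKernel_le_iff]
      intro j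
      rw [le_div_iff₀ (pos_iff_ne_zero.2 h1), le_div_iff₀ (pos_iff_ne_zero.2 h0)]
      have h2 : (kernelPow K j).1 u v * (kernelPow K N).1 v t ≤ (kernelPow K (j + N)).1 u t := by
        rw [kernelPow_add]; exact le_kernelComp _ _ u v t
      calc _ = q.coeff j * ((kernelPow (polyKernel q K) n).1 s u *
            ((kernelPow K j).1 u v * (kernelPow K N).1 v t)) := by ring
        _ ≤ q.coeff j * ((kernelPow (polyKernel q K) n).1 s u * (kernelPow K (j + N)).1 u t) := by
            gcongr
        _ ≤ q.coeff j * (c * Q ^ n * R ^ (j + N)) :=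
            mul_le_mul' le_rfl ((le_kernelComp _ _ s u t).trans (ih (j + N) s t))
        _ = (q.coeff j * R ^ j) * (c * Q ^ n * R ^ N) := by ring
        _ ≤ Q * (c * Q ^ n * R ^ N) := mul_le_mul' (hQ j) le_rfl
        _ = _ := by ring
  refine ⟨c, fun n s t => ?_⟩
  have e : kernelComp (kernelPow (polyKernel q K) n) (kernelPow K 0) =
      kernelPow (polyKernel q K) n :=
    supOp_injective (by simp [supOp_kernelComp, supOp_kernelPow])
  simpa [e] using key n 0 s t

/-- The value `⋁ α_j x ^ j` of a maxpolynomial at a number. -/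
noncomputable def maxPolyVal (q : Polynomial ℝ≥0) (x : ℝ≥0∞) : ℝ≥0∞ :=
  ⨆ j, (q.coeff j : ℝ≥0∞) * x ^ j

theorem maxPolyVal_mono (q : Polynomial ℝ≥0) : Monotone (maxPolyVal q) := fun x y h =>
  iSup_mono fun j => by gcongr

theorem maxPolyVal_eq_sup (q : Polynomial ℝ≥0) (x : ℝ≥0∞) : maxPolyVal q x =
    (Finset.range (q.natDegree + 1)).sup fun j => (q.coeff j : ℝ≥0∞) * x ^ j := by
  refine le_antisymm (iSup_le fun j => ?_) (Finset.sup_le fun j _ => le_iSup_iff.2 fun b h => h j)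
  by_cases hj : j < q.natDegree + 1
  · exact Finset.le_sup (f := fun j => (q.coeff j : ℝ≥0∞) * x ^ j) (Finset.mem_range.2 hj)
  · rw [Polynomial.coeff_eq_zero_of_natDegree_lt (by omega)]
    simp

/-- Continuity needs the supremum to be finite; it lets bounds at growth rates pass to the radius.
-/
theorem continuous_maxPolyVal (q : Polynomial ℝ≥0) : Continuous (maxPolyVal q) := by
  rw [funext (maxPolyVal_eq_sup q)]
  exact Continuous.finset_sup_apply fun j _ =>
    (ENNReal.continuous_const_mul ENNReal.coe_ne_top).comp (ENNReal.continuous_pow j)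

/-- The spectral mapping theorem for maxpolynomials of sup-kernel operators. -/
theorem bonsallRadius_maxPoly_supOp [Nonempty M] (q : Polynomial ℝ≥0) (K : BddKernel M) :
    bonsallRadius (maxPoly q (supOp K)) = maxPolyVal q (bonsallRadius (supOp K)) := by
  rw [maxPoly_supOp]
  apply le_antisymm
  · refine le_apply_bonsallRadius (continuous_maxPolyVal q) fun R _ h => ?_
    have hne : maxPolyVal q R ≠ ∞ := by
      rw [maxPolyVal_eq_sup]
      exact ((Finset.sup_lt_iff ENNReal.zero_lt_top).2 fun j _ => ENNReal.mul_lt_top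
        ENNReal.coe_lt_top (ENNReal.pow_lt_top ENNReal.coe_lt_top)).ne
    lift maxPolyVal q R to ℝ≥0 using hne with Q hQ
    refine bonsallRadius_supOp_le (kernelGrowth_polyKernel h fun j => ?_)
    have : (q.coeff j : ℝ≥0∞) * (R : ℝ≥0∞) ^ j ≤ Q :=
      hQ ▸ le_iSup (fun j => (q.coeff j : ℝ≥0∞) * (R : ℝ≥0∞) ^ j) j
    exact_mod_cast this
  -- Lower half: `α_j^n (K^j)^n ≤ q_∨(K)^n` entrywise, so a growth rate `R` of `q_∨(K)` gives the
  -- rate `R / α_j` for `K^j`.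
  · refine iSup_le fun j => le_apply_bonsallRadius continuous_id fun R _ h => ?_
    rcases eq_or_ne (q.coeff j) 0 with h0 | h0
    · simp [h0]
    have hg : KernelGrowth (kernelPow K j) (R / q.coeff j) := by
      obtain ⟨c, hc⟩ := h
      refine ⟨c, fun n s t => ?_⟩
      rw [div_pow, ← mul_div_assoc, le_div_iff₀ (pow_pos (pos_iff_ne_zero.2 h0) n), mul_comm]
      exact (coeff_pow_mul_le_kernelPow_polyKernel q K j n s t).trans (hc n s t)
    calc _ ≤ (q.coeff j : ℝ≥0∞) * ((R / q.coeff j : ℝ≥0) : ℝ≥0∞) := by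
          gcongr
          exact (pow_bonsallRadius_le K j).trans (bonsallRadius_supOp_le hg)
      _ = R := by rw [← ENNReal.coe_mul, mul_div_cancel₀ _ h0]

theorem coeffPow_coeff {m : ℕ} (hm : m ≠ 0) (q : Polynomial ℝ≥0) (j : ℕ) :
    (coeffPow m q).coeff j = q.coeff j ^ m := by
  simp only [coeffPow, Polynomial.finsetSum_coeff, Polynomial.coeff_monomial]
  rw [Finset.sum_ite_eq']
  split_ifs with h
  · rfl
  · rw [Polynomial.coeff_eq_zero_of_natDegree_lt (by simpa using h), zero_pow hm]

/-- The `m`-th root is an order isomorphism of `[0, ∞]`, hence commutes with the supremum; each term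
is the `m`-th power of `α_j x^j`. -/
theorem maxPolyVal_coeffPow {m : ℕ} (hm : m ≠ 0) (q : Polynomial ℝ≥0) (x : ℝ≥0∞) :
    maxPolyVal (coeffPow m q) (x ^ m) ^ (1 / (m : ℝ)) = maxPolyVal q x := by
  have hm' : (0 : ℝ) < 1 / (m : ℝ) := by positivity
  have h := (ENNReal.orderIsoRpow (1 / (m : ℝ)) hm').map_iSup
    fun j => ((coeffPow m q).coeff j : ℝ≥0∞) * (x ^ m) ^ j
  refine h.trans (iSup_congr fun j => ?_)
  change (_ * _ : ℝ≥0∞) ^ (1 / (m : ℝ)) = _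
  rw [coeffPow_coeff hm, ENNReal.coe_pow, pow_right_comm, ← mul_pow, one_div,
    ENNReal.pow_rpow_inv_natCast hm]

end MaxPolyKernel

/-! ### The inequalities for bounded kernels. -/

section Inequalities

variable {M : Type*}

theorem kernelProd_pair (k h : BddKernel M) : kernelProd [k, h] = kernelComp k h :=
  supOp_injective (by simp [supOp_kernelProd, supOp_kernelComp])

variable [Nonempty M]

theorem maxPoly_hadamard_le (q : Polynomial ℝ≥0) {m : ℕ} (hm : 0 < m) (k : Fin m → BddKernel M) :
    bonsallRadius (maxPoly q (supOp (∏ i, k i))) ≤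
        bonsallRadius (maxPoly (coeffPow m q)
          (supOp (∏ i : Fin m, kernelProd ((List.ofFn k).rotate i)))) ^ (1 / (m : ℝ)) ∧
      bonsallRadius (maxPoly (coeffPow m q)
          (supOp (∏ i : Fin m, kernelProd ((List.ofFn k).rotate i)))) ^ (1 / (m : ℝ)) ≤
        bonsallRadius (maxPoly q (supOp (kernelProd (List.ofFn k)))) := by
  simp only [bonsallRadius_maxPoly_supOp]
  -- The outer members become `m`-th roots of values of `q^{[m]}_∨` at `m`-th powers of radii. By
  -- monotonicity only the arguments remain to be compared.
  rw [← maxPolyVal_coeffPow hm.ne', ← maxPolyVal_coeffPow hm.ne' q]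
  constructor
  · gcongr
    refine maxPolyVal_mono _ ((pow_bonsallRadius_le _ m).trans ?_)
    exact bonsallRadius_supOp_mono (kernelPow_prod_le_prod_rotate k)
  · gcongr
    refine maxPolyVal_mono _ ?_
    simpa using bonsallRadius_prod_le (k := fun i : Fin m => kernelProd ((List.ofFn k).rotate i))
      fun i => bonsallRadius_kernelProd_rotate (List.ofFn k) i

theorem maxPoly_hadamard_two_le (q : Polynomial ℝ≥0) (k h : BddKernel M) :
    bonsallRadius (maxPoly q (supOp (k * h))) ≤
        bonsallRadius (maxPoly (coeffPow 2 q)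
          (supOp (kernelComp k h * kernelComp h k))) ^ (1 / 2 : ℝ) ∧
      bonsallRadius (maxPoly (coeffPow 2 q)
          (supOp (kernelComp k h * kernelComp h k))) ^ (1 / 2 : ℝ) ≤
        bonsallRadius (maxPoly q (supOp (kernelComp k h))) := by
  simpa [Fin.prod_univ_two, kernelProd_pair] using maxPoly_hadamard_le q two_pos ![k, h]

theorem maxPoly_hadamard_comp_le (q : Polynomial ℝ≥0) (k h : BddKernel M) :
    bonsallRadius (maxPoly q (supOp (kernelComp k h * kernelComp h k))) ≤
      bonsallRadius (maxPoly q (supOp (kernelComp (kernelPow k 2) (kernelPow h 2)))) := by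
  obtain ⟨h1, h2⟩ := maxPoly_hadamard_two_le q (kernelComp k h) (kernelComp h k)
  -- It remains to pass from `AB·BA = (AB²)A` to `A(AB²) = A²B²`. Spectral mapping makes the radius
  -- of a maxpolynomial depend only on the radius of its argument, which is invariant under the
  -- cyclic shift.
  refine (h1.trans h2).trans_eq ?_
  have e1 : kernelComp (kernelComp k h) (kernelComp h k) =
      kernelComp (kernelComp k (kernelPow h 2)) k :=
    supOp_injective (by simp [supOp_kernelComp, supOp_kernelPow, pow_two, mul_assoc])
  have e2 : kernelComp k (kernelComp k (kernelPow h 2)) =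
      kernelComp (kernelPow k 2) (kernelPow h 2) :=
    supOp_injective (by simp [supOp_kernelComp, supOp_kernelPow, pow_two, mul_assoc])
  rw [bonsallRadius_maxPoly_supOp, bonsallRadius_maxPoly_supOp, e1,
    bonsallRadius_supOp_comp_comm, e2]

end Inequalities

/-! ### Transfer from bounded functions to the cone of `C[0, a]`. -/

section ContinuousCone

variable {a : ℝ} {T : Function.End (PosCone C(Set.Icc (0 : ℝ) a, ℝ))}
  {K : BddKernel (Set.Icc (0 : ℝ) a)}

theorem norm_toBdd (x : PosCone C(Set.Icc (0 : ℝ) a, ℝ)) : ‖(toBdd x).1‖ = ‖x.1‖ := by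
  apply le_antisymm
  · exact BddFun.norm_le_of_forall_le (norm_nonneg _) fun s =>
      (le_abs_self _).trans (x.1.norm_coe_le_norm s)
  · refine (ContinuousMap.norm_le _ (norm_nonneg _)).2 fun s => ?_
    rw [Real.norm_of_nonneg (show 0 ≤ x.1 s from x.2 s)]
    exact BddFun.apply_le_norm (toBdd x).1 s

theorem enorm_toBdd (x : PosCone C(Set.Icc (0 : ℝ) a, ℝ)) : ‖(toBdd x).1‖ₑ = ‖x.1‖ₑ := by
  rw [← ofReal_norm, ← ofReal_norm, norm_toBdd]

theorem HasKernel.pow (h : HasKernel T K) (n : ℕ) : HasKernel (T ^ n) (kernelPow K n) := by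
  induction n with
  | zero =>
    rw [hasKernel_iff]
    intro x
    rw [kernelPow_zero, supOp_kernelId]
    rfl
  | succ n ih => rw [pow_succ']; exact h.mul ih

theorem HasKernel.maxPoly (h : HasKernel T K) (q : Polynomial ℝ≥0) :
    HasKernel (maxPoly q T) (polyKernel q K) := by
  rw [hasKernel_iff]
  intro x
  rw [← maxPoly_supOp]
  refine (Finset.apply_sup_eq_sup_comp toBdd (fun _ _ => rfl) rfl).trans ?_
  refine Finset.sup_congr rfl fun j _ => Subtype.ext ?_
  have e : (supOp K ^ j) (toBdd x) = toBdd ((T ^ j) x) := by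
    rw [← supOp_kernelPow, ← hasKernel_iff.1 (h.pow j) x]
  change _ = (q.coeff j : ℝ) • ((supOp K ^ j) (toBdd x)).1
  rw [e]
  rfl

/-- One direction holds because `toBdd` is isometric and intertwines the maps. In the other, the
continuous function `1` already detects the norm: `K(s, t) ≤ (T 1)(s)`, hence `‖supOp K f‖ ≤ ‖T 1‖
‖f‖` for every bounded `f`. -/
theorem HasKernel.coneNorm_eq (h : HasKernel T K) : coneNorm T = coneNorm (supOp K) := by
  have hT := hasKernel_iff.1 h
  apply le_antisymm
  · refine iSup₂_le fun x hx => ?_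
    rw [← enorm_toBdd, ← enorm_toBdd, hT]
    refine le_iSup₂ (f := fun (f : PosCone (BddFun (Set.Icc (0 : ℝ) a))) (_ : f.1 ≠ 0) =>
      ‖(supOp K f).1‖ₑ / ‖f.1‖ₑ) (toBdd x) ?_
    rwa [← norm_ne_zero_iff, norm_toBdd, norm_ne_zero_iff]
  · refine iSup₂_le fun f hf => ?_
    rw [ENNReal.div_le_iff (by simpa using hf) (by simp)]
    let e : PosCone C(Set.Icc (0 : ℝ) a, ℝ) := ⟨1, fun _ => zero_le_one⟩
    have h1 : ‖(supOp K f).1‖ ≤ ‖(T e).1‖ * ‖f.1‖ := by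
      refine BddFun.norm_le_of_forall_le (by positivity) fun s => ?_
      rw [supOp_apply_le_iff]
      intro t
      have h2 : (K.1 s t : ℝ) ≤ ‖(T e).1‖ := by
        rw [← norm_toBdd, hT]
        refine le_trans ?_ (BddFun.apply_le_norm _ s)
        simpa using (supOp_apply_le_iff K (toBdd e) s).1 le_rfl t |>.trans' (mul_one _).ge
      exact mul_le_mul h2 (f.1.apply_le_norm t) (f.2 t) (norm_nonneg _)
    have h2 : ‖(supOp K f).1‖ₑ ≤ ‖(T e).1‖ₑ * ‖f.1‖ₑ := by
      have : ‖(supOp K f).1‖₊ ≤ ‖(T e).1‖₊ * ‖f.1‖₊ := h1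
      simp only [enorm_eq_nnnorm]
      exact_mod_cast this
    refine h2.trans (mul_le_mul' ?_ le_rfl)
    have h3 : ‖(T e).1‖ₑ ≤ coneNorm T * ‖e.1‖ₑ := by
      refine enorm_le_coneNorm_mul (fun x hx => ?_) e
      rw [← norm_eq_zero, ← norm_toBdd, hT, norm_eq_zero]
      exact supOp_zero K _ (by rw [← norm_eq_zero, norm_toBdd, hx, norm_zero])
    refine h3.trans ((mul_le_mul' le_rfl ?_).trans (mul_one _).le)
    have : ‖e.1‖ ≤ 1 := (ContinuousMap.norm_le _ zero_le_one).2 fun s => by simp [e]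
    have : ‖e.1‖₊ ≤ 1 := this
    rw [enorm_eq_nnnorm]
    exact_mod_cast this

/-- A map of the cone of `C[0, a]` has the spectral radius of the sup-kernel operator with the same
kernel. -/
theorem HasKernel.bonsallRadius_eq (h : HasKernel T K) :
    bonsallRadius T = bonsallRadius (supOp K) := by
  simp only [bonsallRadius, (h.pow _).coneNorm_eq, supOp_kernelPow]

theorem HasKernel.bonsallRadius_maxPoly_eq (h : HasKernel T K) (q : Polynomial ℝ≥0) :
    bonsallRadius (_root_.maxPoly q T) = bonsallRadius (_root_.maxPoly q (supOp K)) := by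
  rw [(h.maxPoly q).bonsallRadius_eq, maxPoly_supOp]

theorem Band.Kernel.extend_mul {D : Band a} (k h : D.Kernel) :
    Band.Kernel.extend (k * h) = k.extend * h.extend := by
  refine Subtype.ext (funext₂ fun s t => ?_)
  change _ = k.extend.1 s t * h.extend.1 s t
  by_cases hst : (s, t) ∈ D.region <;> simp [Band.Kernel.extend, hst]

/-- For an empty index set the left side would be the indicator of the region and the right side the
constant `1`. -/
theorem Band.Kernel.extend_prod {D : Band a} {ι : Type*} {S : Finset ι} (hS : S.Nonempty)
    (k : ι → D.Kernel) : Band.Kernel.extend (∏ i ∈ S, k i) = ∏ i ∈ S, (k i).extend := by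
  induction hS using Finset.Nonempty.cons_induction with
  | singleton i => simp
  | cons i S hi _ ih =>
    rw [Finset.prod_cons, Finset.prod_cons, ← ih]
    exact Band.Kernel.extend_mul _ _

end ContinuousCone

theorem theorem5p5 (q : Polynomial ℝ≥0) :
    -- sup-kernel operators on the bounded functions on a nonempty set `M`
    (∀ (M : Type*) [Nonempty M],
      (∀ (m : ℕ) (_ : 0 < m) (k : Fin m → BddKernel M),
        bonsallRadius (maxPoly q (supOp (∏ i, k i))) ≤
            bonsallRadius (maxPoly (coeffPow m q)
              (supOp (∏ i : Fin m, kernelProd ((List.ofFn k).rotate i)))) ^ (1 / (m : ℝ)) ∧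
          bonsallRadius (maxPoly (coeffPow m q)
              (supOp (∏ i : Fin m, kernelProd ((List.ofFn k).rotate i)))) ^ (1 / (m : ℝ)) ≤
            bonsallRadius (maxPoly q (List.ofFn fun i => supOp (k i)).prod)) ∧
      ∀ k h : BddKernel M,
        (bonsallRadius (maxPoly q (supOp (k * h))) ≤
            bonsallRadius (maxPoly (coeffPow 2 q)
              (supOp (kernelComp k h * kernelComp h k))) ^ (1 / 2 : ℝ) ∧
          bonsallRadius (maxPoly (coeffPow 2 q)
              (supOp (kernelComp k h * kernelComp h k))) ^ (1 / 2 : ℝ) ≤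
            bonsallRadius (maxPoly q (supOp k * supOp h))) ∧
        bonsallRadius (maxPoly q (supOp (kernelComp k h * kernelComp h k))) ≤
          bonsallRadius (maxPoly q (supOp k ^ 2 * supOp h ^ 2))) ∧
    -- max-type kernel operators on `C[0, a]` with fixed `α ≤ β`; the Hadamard products of the
    -- products of these operators act on all bounded functions, and are considered on `C[0, a]`
    -- whenever they preserve the nonnegative continuous functions
    (∀ (a : ℝ) (_ : 0 < a) (D : Band a),
      (∀ (m : ℕ) (_ : 0 < m) (k : Fin m → D.Kernel),
        (bonsallRadius (maxPoly q (maxOp (∏ i, k i))) ≤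
            bonsallRadius (maxPoly (coeffPow m q) (supOp (∏ i : Fin m,
              kernelProd ((List.ofFn fun j => (k j).extend).rotate i)))) ^ (1 / (m : ℝ)) ∧
          bonsallRadius (maxPoly (coeffPow m q) (supOp (∏ i : Fin m,
              kernelProd ((List.ofFn fun j => (k j).extend).rotate i)))) ^ (1 / (m : ℝ)) ≤
            bonsallRadius (maxPoly q (List.ofFn fun i => maxOp (k i)).prod)) ∧
        ∀ T : Function.End (PosCone C(Set.Icc (0 : ℝ) a, ℝ)),
          HasKernel T (∏ i : Fin m, kernelProd ((List.ofFn fun j => (k j).extend).rotate i)) →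
            bonsallRadius (maxPoly q (maxOp (∏ i, k i))) ≤
                bonsallRadius (maxPoly (coeffPow m q) T) ^ (1 / (m : ℝ)) ∧
              bonsallRadius (maxPoly (coeffPow m q) T) ^ (1 / (m : ℝ)) ≤
                bonsallRadius (maxPoly q (List.ofFn fun i => maxOp (k i)).prod)) ∧
      ∀ k h : D.Kernel,
        ((bonsallRadius (maxPoly q (maxOp (k * h))) ≤
            bonsallRadius (maxPoly (coeffPow 2 q) (supOp
              (kernelComp k.extend h.extend * kernelComp h.extend k.extend))) ^ (1 / 2 : ℝ) ∧
          bonsallRadius (maxPoly (coeffPow 2 q) (supOp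
              (kernelComp k.extend h.extend * kernelComp h.extend k.extend))) ^ (1 / 2 : ℝ) ≤
            bonsallRadius (maxPoly q (maxOp k * maxOp h))) ∧
        bonsallRadius (maxPoly q (supOp
            (kernelComp k.extend h.extend * kernelComp h.extend k.extend))) ≤
          bonsallRadius (maxPoly q (maxOp k ^ 2 * maxOp h ^ 2))) ∧
        ∀ T : Function.End (PosCone C(Set.Icc (0 : ℝ) a, ℝ)),
          HasKernel T (kernelComp k.extend h.extend * kernelComp h.extend k.extend) →
            (bonsallRadius (maxPoly q (maxOp (k * h))) ≤
                bonsallRadius (maxPoly (coeffPow 2 q) T) ^ (1 / 2 : ℝ) ∧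
              bonsallRadius (maxPoly (coeffPow 2 q) T) ^ (1 / 2 : ℝ) ≤
                bonsallRadius (maxPoly q (maxOp k * maxOp h))) ∧
            bonsallRadius (maxPoly q T) ≤
              bonsallRadius (maxPoly q (maxOp k ^ 2 * maxOp h ^ 2))) := by
  refine ⟨fun M _ => ⟨fun m hm k => ?_, fun k h => ⟨?_, ?_⟩⟩, fun a ha D => ⟨fun m hm k => ?_,
    fun k h => ?_⟩⟩
  · have e : (List.ofFn fun i => supOp (k i)).prod = supOp (kernelProd (List.ofFn k)) := by
      rw [supOp_kernelProd, List.map_ofFn]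
      rfl
    rw [e]
    exact maxPoly_hadamard_le q hm k
  · rw [← supOp_kernelComp]
    exact maxPoly_hadamard_two_le q k h
  · rw [← supOp_kernelPow, ← supOp_kernelPow, ← supOp_kernelComp]
    exact maxPoly_hadamard_comp_le q k h
  · have : Nonempty (Set.Icc (0 : ℝ) a) := ⟨⟨0, le_rfl, ha.le⟩⟩
    have : Nonempty (Fin m) := ⟨⟨0, hm⟩⟩
    have e1 : HasKernel (maxOp (∏ i, k i)) (∏ i, (k i).extend) := by
      rw [← Band.Kernel.extend_prod Finset.univ_nonempty]
      exact hasKernel_maxOp _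
    have e2 : HasKernel (List.ofFn fun i => maxOp (k i)).prod
        (kernelProd (List.ofFn fun j => (k j).extend)) := by
      have := hasKernel_prod (List.ofFn k)
      rwa [List.map_ofFn, List.map_ofFn] at this
    -- Once every map is replaced by the sup-kernel operator of its kernel, both readings of the
    -- Hadamard product of the `P_i` give this one statement about bounded functions on `[0, a]`.
    have key := maxPoly_hadamard_le q hm fun i => (k i).extend
    rw [e1.bonsallRadius_maxPoly_eq, e2.bonsallRadius_maxPoly_eq]
    refine ⟨key, fun T hT => ?_⟩
    rw [hT.bonsallRadius_maxPoly_eq]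
    exact key
  · have : Nonempty (Set.Icc (0 : ℝ) a) := ⟨⟨0, le_rfl, ha.le⟩⟩
    have e1 : HasKernel (maxOp (k * h)) (k.extend * h.extend) := by
      rw [← Band.Kernel.extend_mul]
      exact hasKernel_maxOp _
    have e2 := (hasKernel_maxOp k).mul (hasKernel_maxOp h)
    have e3 := ((hasKernel_maxOp k).pow 2).mul ((hasKernel_maxOp h).pow 2)
    have key := maxPoly_hadamard_two_le q k.extend h.extend
    have key' := maxPoly_hadamard_comp_le q k.extend h.extend
    rw [e1.bonsallRadius_maxPoly_eq, e2.bonsallRadius_maxPoly_eq, e3.bonsallRadius_maxPoly_eq]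
    refine ⟨⟨key, key'⟩, fun T hT => ?_⟩
    rw [hT.bonsallRadius_maxPoly_eq, hT.bonsallRadius_maxPoly_eq]
    exact ⟨key, key'⟩
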